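/- A ray in a graph $G$ is a one-way infinite path in $G$; a tail of a ray is an infinite connected subgraph of it, and two rays are tail-equivalent if they share a common tail. Let $\mathcal G$ be the class of all graphs $G$ such that for every vertex $v$ of $G$ the subgraph of $G$ induced on the set of neighbours of $v$ has at most one ray up to tail-equivalence. For a cardinal $\lambda$ let $\mathcal G_\lambda$ be the set of isomorphism types of graphs in $\mathcal G$ with exactly $\lambda$ vertices. Write $G\le_w G'$ if $G$ is isomorphic to a (not necessarily induced) subgraph of $G'$. The weak complexity $\mathrm{wcp}\,\mathcal G_\lambda$ is the least cardinality of a set $D\subseteq\mathcal G_\lambda$ such that for every $G\in\mathcal G_\lambda$ there is $G'\in D$ with $G\le_w G'$. Corollary 1.9: For every regular cardinal $\lambda>\aleph_1$, $$\mathrm{wcp}\,\mathcal G_\lambda\ \ge\ \max\{\lambda^+,\,2^{\aleph_0}\}.$$ -/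

import Mathlib

open Cardinal

universe u

namespace UncountableGraphs

/-- A ray in a graph: a one-way infinite path, given by its vertices in order
`R 0, R 1, R 2, …`, all distinct, consecutive ones being adjacent. -/
structure Ray {V : Type u} (G : SimpleGraph V) where
  /-- The `n`-th vertex of the ray. -/
  vertex : ℕ → V
  injective : Function.Injective vertex
  adj : ∀ n, G.Adj (vertex n) (vertex (n + 1))

/-- `T` is a tail of the ray `R`. The infinite connected subgraphs of a ray are exactly the
rays obtained from it by deleting finitely many vertices at the beginning. -/
def Ray.IsTail {V : Type u} {G : SimpleGraph V} (T R : Ray G) : Prop :=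
  ∃ m : ℕ, ∀ n : ℕ, T.vertex n = R.vertex (m + n)

/-- Two rays are tail-equivalent if they share a common tail. -/
def Ray.TailEquivalent {V : Type u} {G : SimpleGraph V} (R R' : Ray G) : Prop :=
  ∃ T : Ray G, T.IsTail R ∧ T.IsTail R'

/-- A class of graphs (with vertex types in the universe `u`). -/
abbrev GraphClass : Type (u + 1) := (V : Type u) → SimpleGraph V → Prop

/-- The class of all graphs `G` such that, for every vertex `v`, the subgraph of `G` induced on
the neighbourhood of `v` has at most one ray up to tail-equivalence. -/
def OneRay : GraphClass.{u} := fun V G =>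
  ∀ v : V, ∀ R R' : Ray (G.induce (G.neighborSet v)), R.TailEquivalent R'

/-- The members of the class `C` whose vertex set is a fixed set of cardinality `κ`. -/
abbrev GraphClass.Member (C : GraphClass.{u}) (κ : Cardinal.{u}) : Type u :=
  {G : SimpleGraph κ.out // C _ G}

/-- Isomorphism of graphs. -/
instance GraphClass.isoSetoid (C : GraphClass.{u}) (κ : Cardinal.{u}) :
    Setoid (C.Member κ) where
  r G H := Nonempty (G.1 ≃g H.1)
  iseqv := ⟨fun _ => ⟨.refl⟩, fun ⟨e⟩ => ⟨e.symm⟩, fun ⟨e⟩ ⟨f⟩ => ⟨e.trans f⟩⟩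

/-- The set of isomorphism types of graphs of cardinality `κ` in the class `C`. -/
def GraphClass.OfCard (C : GraphClass.{u}) (κ : Cardinal.{u}) : Type u :=
  Quotient (GraphClass.isoSetoid C κ)

/-- The weak embeddability relation on isomorphism types: the first graph is isomorphic to a
(not necessarily induced) subgraph of the second. -/
def GraphClass.OfCard.WeakLE {C : GraphClass.{u}} {κ : Cardinal.{u}} (x y : C.OfCard κ) : Prop :=
  Quotient.liftOn₂ x y (fun G H => G.1.IsContained H.1)
    (fun _ _ _ _ ⟨e⟩ ⟨f⟩ => propext
      ⟨fun ⟨h⟩ => ⟨f.toCopy.comp (h.comp e.symm.toCopy)⟩,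
       fun ⟨h⟩ => ⟨f.symm.toCopy.comp (h.comp e.toCopy)⟩⟩)

/-- The weak complexity of the class `C` at the cardinal `κ`: the least cardinality of a set `D`
of members of cardinality `κ` such that every member of cardinality `κ` is weakly embeddable
in a member of `D`. -/
noncomputable def GraphClass.weakComplexity (C : GraphClass.{u}) (κ : Cardinal.{u}) :
    Cardinal.{u} :=
  sInf {c | ∃ D : Set (C.OfCard κ), #D = c ∧ ∀ x : C.OfCard κ, ∃ y ∈ D, x.WeakLE y}

/-- The class `OneRay` is closed under isomorphism. -/
theorem OneRay.of_iso {V W : Type u} {G : SimpleGraph V} {H : SimpleGraph W} (e : G ≃g H)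
    (hG : OneRay V G) : OneRay W H := by
  intro w R R'
  have key : ∀ x : H.neighborSet w, e.symm x.1 ∈ G.neighborSet (e.symm w) := fun x =>
    e.symm.map_adj_iff.2 x.2
  let f : Ray (H.induce (H.neighborSet w)) → Ray (G.induce (G.neighborSet (e.symm w))) :=
    fun Q =>
      { vertex := fun n => ⟨e.symm (Q.vertex n).1, key _⟩
        injective := fun a b hab => Q.injective (Subtype.ext (e.symm.injective
          (congrArg Subtype.val hab)))
        adj := fun n => e.symm.map_adj_iff.2 (Q.adj n) }
  have val : ∀ Q n, ((f Q).vertex n).1 = e.symm (Q.vertex n).1 := fun _ _ => rfl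
  obtain ⟨T, ⟨m, hm⟩, ⟨m', hm'⟩⟩ := hG (e.symm w) (f R) (f R')
  refine ⟨⟨fun n => R.vertex (m + n), fun a b hab => ?_, fun n => R.adj (m + n)⟩,
    ⟨m, fun _ => rfl⟩, ⟨m', fun n => ?_⟩⟩
  · exact Nat.add_left_cancel (R.injective hab)
  · apply Subtype.ext
    apply e.symm.injective
    rw [← val, ← val, ← hm, ← hm']

/-- Nothing is lost by fixing the vertex set: every graph of cardinality `κ` in the class
`OneRay` is isomorphic to one on the chosen vertex set. -/
theorem OneRay.exists_iso_member {V : Type u} {κ : Cardinal.{u}} (hV : #V = κ)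
    (G : SimpleGraph V) (hG : OneRay V G) :
    ∃ H : GraphClass.Member OneRay κ, Nonempty (G ≃g H.1) := by
  have hc : #V = #κ.out := by rw [hV, mk_out]
  obtain ⟨f⟩ := Cardinal.eq.1 hc
  exact ⟨⟨G.map f.toEmbedding, OneRay.of_iso (SimpleGraph.Iso.map f G) hG⟩,
    ⟨SimpleGraph.Iso.map f G⟩⟩

end UncountableGraphs

/-
Let fewer than the asserted number of graphs `G j` in the class be given, on a vertex set of
cardinality `κ`. For every vertex `v` of `G j`, all rays in the neighbourhood of `v` have a common
tail, which runs along a sequence `ρ v`.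

For `succ κ`: deleting the tails of `ρ v` from the neighbourhood of `v` leaves at most `κ` rayless
graphs. Order the finite paths in these by extension, which is a well-founded relation `r`, and join
an apex to those nodes of a tree of finite sequences that are `r`-descending and to one further
branch. If this is contained in `G j`, the branch lies on `ρ v` eventually, where `v` is the image
of the apex. So the descending sequences are mapped to one of the rayless graphs, and recording
these images gives a descending sequence that can be extended forever, a contradiction.

For `2 ^ ℵ₀`, where `κ < 2 ^ ℵ₀` may be assumed: code `x : ℕ → Bool` by the tree of finite sequences
in `κ`, with an apex for every `i < κ` joined to a branch that is a subsequence, chosen by `x`, of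
the `i`-th sequence `c i` of a club guessing system. If the graph for `x` is contained in `G j`,
then for some `i` all points of `c i` lie in the club of those `δ` below which the embedding of the
tree is closed in both directions. Hence the image of the `n`-th node of the branch lies below
`c i (2 * n + 1)` iff all entries of that node do, and comparing `ρ v`, where `v` is the image of
the apex `i`, with `c i` recovers `x`. There are too few choices of `j`, `i`, `v` and the two
starting points of the common tail for `2 ^ ℵ₀` many `x`.
-/

namespace UncountableGraphs

section ClubGuessing

open Set Order

variable {A : Type u} [LinearOrder A]

theorem bddAbove_of_mk_lt_cof {s : Set A} (hs : #s < cof A) : BddAbove s :=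
  .of_not_isCofinal fun h => (cof_le h).not_gt hs

theorem nonempty_of_aleph0_lt_cof (hA : ℵ₀ < cof A) : Nonempty A :=
  cof_ne_zero_iff.1 (aleph0_pos.trans hA).ne'

theorem noMaxOrder_of_aleph0_lt_cof (hA : ℵ₀ < cof A) : NoMaxOrder A :=
  have := nonempty_of_aleph0_lt_cof hA
  (noTopOrder_iff_noMaxOrder A).1 (one_lt_cof_iff.1 (one_lt_aleph0.trans hA))

/-- A ladder on `δ`: a strictly increasing `ω`-sequence with supremum `δ`. -/
def IsLadder (s : ℕ → A) (δ : A) : Prop := StrictMono s ∧ IsLUB (range s) δ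

variable [WellFoundedLT A]

theorem exists_isClub_forall_lt_subset {B : Type u} [Preorder B] [WellFoundedLT B]
    (hA : cof A ≠ ℵ₀) (hB : #B < cof A) (a : A) {G : Set A → Set A}
    (hG : ∀ E, IsClub E → a ∈ E → IsClub (G E) ∧ a ∈ G E) :
    ∃ E : B → Set A, (∀ i, IsClub (E i) ∧ a ∈ E i) ∧ ∀ i j, i < j → E j ⊆ E i ∩ G (E i) := by
  obtain ⟨E, hE⟩ : ∃ E : B → Set A, ∀ i, E i = ⋂ j : Iio i, E j ∩ G (E j) :=
    ⟨wellFounded_lt.fix fun i F => ⋂ j : Iio i, F j j.2 ∩ G (F j j.2), wellFounded_lt.fix_eq _⟩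
  refine ⟨E, fun i => ?_, fun i j hij => (hE j).subset.trans (iInter_subset _ (⟨i, hij⟩ : Iio j))⟩
  induction i using WellFoundedLT.induction with
  | _ i ih =>
    rw [hE i]
    refine ⟨.iInter hA (lift_lt.2 ((mk_set_le _).trans_lt hB)) fun j => ?_,
      mem_iInter.2 fun j => ?_⟩
    · exact (ih j j.2).1.inter hA (hG _ (ih j j.2).1 (ih j j.2).2).1
    · exact ⟨(ih j j.2).2, (hG _ (ih j j.2).1 (ih j j.2).2).2⟩

theorem exists_forall_ge_eq_of_antitone {B : Type*} [LinearOrder B]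
    (hB : ℵ₀ < cof B) (h : B → ℕ → A) (hanti : Antitone h) : ∃ i, ∀ j ≥ i, h j = h i := by
  have := nonempty_of_aleph0_lt_cof hB
  have hmin (n : ℕ) : ∃ i, ∀ j, h i n ≤ h j n := by
    obtain ⟨_, ⟨i, rfl⟩, hi⟩ := wellFounded_lt.has_min (range (h · n)) (range_nonempty _)
    exact ⟨i, fun j => not_lt.1 (hi _ ⟨j, rfl⟩)⟩
  choose I hI using hmin
  obtain ⟨i, hi⟩ := bddAbove_of_mk_lt_cof ((countable_range I).le_aleph0.trans_lt hB)
  exact ⟨i, fun j hj => funext fun n =>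
    (hanti hj n).antisymm ((hanti (hi ⟨n, rfl⟩) n).trans (hI n j))⟩

theorem exists_isLUB_of_bddAbove {s : Set A} (hs : BddAbove s) : ∃ a, IsLUB s a := by
  obtain ⟨a, ha, hmin⟩ := wellFounded_lt.has_min (upperBounds s) hs
  exact ⟨a, ha, fun b hb => not_lt.1 (hmin b hb)⟩

theorem exists_ladder_isLUB_inter_Iio (hA : ℵ₀ < cof A) {E : Set A} (hE : IsClub E) :
    ∃ δ, (∃ s, IsLadder s δ) ∧ IsLUB (E ∩ Iio δ) δ := by
  have := nonempty_of_aleph0_lt_cof hA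
  have := noMaxOrder_of_aleph0_lt_cof hA
  have : Nonempty E := hE.nonempty.to_subtype
  have : NoMaxOrder E := ⟨fun a =>
    let ⟨b, hb⟩ := exists_gt (a : A)
    let ⟨e, he, hbe⟩ := hE.isCofinal b
    ⟨⟨e, he⟩, hb.trans_le hbe⟩⟩
  obtain ⟨t, ht⟩ := Nat.exists_strictMono E
  obtain ⟨δ, hlub⟩ : ∃ δ, IsLUB (range fun n => (t n : A)) δ := exists_isLUB_of_bddAbove <|
    bddAbove_of_mk_lt_cof ((countable_range _).le_aleph0.trans_lt hA)
  refine ⟨δ, ⟨fun n => t n, ht, hlub⟩, fun a ha => ha.2.le, fun b hb => hlub.2 ?_⟩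
  rintro _ ⟨n, rfl⟩
  have hlt : (t n : A) < t (n + 1) := ht n.lt_succ_self
  exact hb ⟨(t n).2, hlt.trans_le (hlub.1 ⟨n + 1, rfl⟩)⟩

section LastBelow

variable {A : Type u} [ConditionallyCompleteLinearOrderBot A]

/-- The greatest element of `E` that is at most `α`, for a club `E` containing `⊥`. -/
noncomputable def lastBelow (E : Set A) (α : A) : A := sSup (E ∩ Iic α)

theorem lastBelow_le (E : Set A) (α : A) : lastBelow E α ≤ α := csSup_le' fun _ h => h.2

theorem le_lastBelow {E : Set A} {α β : A} (hβ : β ∈ E) (h : β ≤ α) : β ≤ lastBelow E α :=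
  le_csSup bddAbove_Iic.inter_of_right ⟨hβ, h⟩

theorem lastBelow_mem {E : Set A} (hE : IsClub E) (hbot : ⊥ ∈ E) (α : A) : lastBelow E α ∈ E :=
  hE.csSup_mem inter_subset_left ⟨⊥, hbot, bot_le⟩ bddAbove_Iic.inter_of_right

theorem lastBelow_anti {E F : Set A} (h : E ⊆ F) (α : A) : lastBelow E α ≤ lastBelow F α :=
  csSup_le_csSup' bddAbove_Iic.inter_of_right (inter_subset_inter_left _ h)

theorem exists_forall_lastBelow_mem [WellFoundedLT A] (hA : ℵ_ 1 < cof A) (C : A → ℕ → A) :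
    ∃ E, IsClub E ∧ ⊥ ∈ E ∧ ∀ D, IsClub D → ⊥ ∈ D →
      ∃ δ, (∃ s, IsLadder s δ) ∧ IsLUB (E ∩ Iio δ) δ ∧ ∀ n, lastBelow E (C δ n) ∈ D := by
  by_contra! hcon
  choose! G hG hGbot hGC using hcon
  let B := (ℵ_ 1 : Cardinal.{u}).ord.ToType
  have hB : ℵ₀ < cof B := by
    rw [Ordinal.cof_toType, isRegular_aleph_one.cof_ord]; exact aleph0_lt_aleph_one
  have hAcof : cof A ≠ ℵ₀ := (aleph0_lt_aleph_one.trans hA).ne'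
  have := nonempty_of_aleph0_lt_cof hB
  have := noMaxOrder_of_aleph0_lt_cof hB
  have hsmall : #B < cof A := by rwa [mk_ord_toType]
  obtain ⟨E, hEclub, hEG⟩ := exists_isClub_forall_lt_subset (B := B) hAcof hsmall ⊥
    fun E hE hbot => ⟨hG E hE hbot, hGbot E hE hbot⟩
  have hEanti : Antitone E := antitone_iff_forall_lt.2 fun _ _ h =>
    (hEG _ _ h).trans inter_subset_left
  obtain ⟨δ, hladder, hδ⟩ := exists_ladder_isLUB_inter_Iio (aleph0_lt_aleph_one.trans hA)
    (IsClub.iInter hAcof (lift_lt.2 hsmall) fun i => (hEclub i).1)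
  obtain ⟨i, hi⟩ := exists_forall_ge_eq_of_antitone hB (fun i n => lastBelow (E i) (C δ n))
    fun _ _ h n => lastBelow_anti (hEanti h) _
  obtain ⟨j, hij⟩ := exists_gt i
  have hδi : IsLUB (E i ∩ Iio δ) δ :=
    ⟨fun _ h => h.2.le, fun b hb => hδ.2 fun x hx => hb ⟨mem_iInter.1 hx.1 i, hx.2⟩⟩
  obtain ⟨n, hn⟩ := hGC (E i) (hEclub i).1 (hEclub i).2 δ hladder hδi
  refine hn ((hEG i j hij).trans inter_subset_right ?_)
  rw [← congrFun (hi j hij.le) n]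
  exact lastBelow_mem (hEclub j).1 (hEclub j).2 _

theorem exists_strictMono_lastBelow {E : Set A} {s : ℕ → A} {δ : A} (hs : IsLadder s δ)
    (hδ : IsLUB (E ∩ Iio δ) δ) :
    ∃ c : ℕ → A, StrictMono c ∧ ∀ n, ∃ k, c n = lastBelow E (s k) := by
  let t := range fun n => lastBelow E (s n)
  have : Nonempty t := ⟨⟨_, 0, rfl⟩⟩
  have : NoMaxOrder t := ⟨by
    rintro ⟨_, n, rfl⟩
    have hlt : lastBelow E (s n) < δ := (lastBelow_le E _).trans_lt
      ((hs.1 n.lt_succ_self).trans_le (hs.2.1 ⟨n + 1, rfl⟩))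
    obtain ⟨ε, ⟨hε, hεδ⟩, hlt'⟩ := (lt_isLUB_iff hδ).1 hlt
    obtain ⟨_, ⟨k, rfl⟩, hk⟩ := (lt_isLUB_iff hs.2).1 hεδ
    exact ⟨⟨_, k, rfl⟩, hlt'.trans_le (le_lastBelow hε hk.le)⟩⟩
  obtain ⟨c, hc⟩ := Nat.exists_strictMono t
  exact ⟨fun n => c n, hc, fun n => (c n).2.imp fun _ => Eq.symm⟩

end LastBelow

theorem exists_club_guessing (hA : ℵ_ 1 < cof A) :
    ∃ c : A → ℕ → A, (∀ δ, StrictMono (c δ)) ∧ ∀ D, IsClub D → ∃ δ, ∀ n, c δ n ∈ D := by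
  have := nonempty_of_aleph0_lt_cof (aleph0_lt_aleph_one.trans hA)
  let _ := WellFoundedLT.toOrderBot A
  let _ := WellFoundedLT.conditionallyCompleteLinearOrderBot A
  have := noMaxOrder_of_aleph0_lt_cof (aleph0_lt_aleph_one.trans hA)
  have hladder (δ : A) : ∃ s, (∃ s, IsLadder s δ) → IsLadder s δ := by
    by_cases h : ∃ s, IsLadder s δ
    · exact h.imp fun _ hs _ => hs
    · exact ⟨fun _ => δ, fun h' => absurd h' h⟩
  choose C hC using hladder
  obtain ⟨E, -, -, hguess⟩ := exists_forall_lastBelow_mem hA C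
  have hladder' (δ : A) : ∃ c : ℕ → A, StrictMono c ∧
      ((∃ s, IsLadder s δ) ∧ IsLUB (E ∩ Iio δ) δ → ∀ n, ∃ k, c n = lastBelow E (C δ k)) := by
    by_cases h : (∃ s, IsLadder s δ) ∧ IsLUB (E ∩ Iio δ) δ
    · exact (exists_strictMono_lastBelow (hC δ h.1) h.2).imp fun _ hc => ⟨hc.1, fun _ => hc.2⟩
    · exact (Nat.exists_strictMono A).imp fun _ hc => ⟨hc, fun h' => absurd h' h⟩
  choose c hc hcE using hladder'
  refine ⟨fun δ n => c δ (n + 1), fun δ => (hc δ).comp (strictMono_id.add_const 1), fun D hD => ?_⟩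
  have hDbot : IsClub (insert ⊥ D) :=
    ⟨(PartialOrder.dirSupClosed_singleton _).union hD.dirSupClosed,
      hD.isCofinal.mono (subset_insert _ _)⟩
  obtain ⟨δ, hδ, hEδ, hmem⟩ := hguess _ hDbot (mem_insert _ _)
  refine ⟨δ, fun n => ?_⟩
  obtain ⟨k, hk⟩ := hcE δ ⟨hδ, hEδ⟩ (n + 1)
  exact (hk ▸ hmem k).resolve_left ((hc δ n.lt_succ_self).bot_lt.ne')

theorem isClub_setOf_forall_lt [IsRegularCardinalOrder A] (hA : ℵ₀ < #A) (f : A → A) :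
    IsClub {δ | ∀ α < δ, f α < δ} := by
  have hcof : cof A = #A := cof_eq_cardinalMk
  have := noMaxOrder_of_aleph0_lt_cof (hcof ▸ hA)
  refine ⟨fun s hs _ _ δ hδ α hα => ?_, fun a => ?_⟩
  · obtain ⟨ε, hε, hαε⟩ := (lt_isLUB_iff hδ).1 hα
    exact (hs hε α hαε).trans_le (hδ.1 hε)
  have hstep (b : A) : ∃ b', ∀ α ≤ b, f α < b' := by
    obtain ⟨u, hu⟩ : BddAbove (f '' Iic b) := bddAbove_of_mk_lt_cof <|
      mk_image_le.trans_lt (hcof ▸ mk_Iic_lt b ord_cardinalMk hA.le)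
    exact (exists_gt u).imp fun b' hb' α hα => (hu (mem_image_of_mem f hα)).trans_lt hb'
  choose g hg using hstep
  obtain ⟨δ, hlub⟩ : ∃ δ, IsLUB (range fun n => g^[n] a) δ := exists_isLUB_of_bddAbove <|
    bddAbove_of_mk_lt_cof ((countable_range _).le_aleph0.trans_lt (hcof ▸ hA))
  refine ⟨δ, fun α hα => ?_, hlub.1 ⟨0, rfl⟩⟩
  obtain ⟨_, ⟨n, rfl⟩, hn⟩ := (lt_isLUB_iff hlub).1 hα
  exact (hg _ α hn.le).trans_le (hlub.1 ⟨n + 1, Function.iterate_succ_apply' g n a⟩)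

theorem exists_isClub_forall_mem_lt_iff [IsRegularCardinalOrder A] (hA : ℵ₀ < #A)
    {w : List A → A} (hw : Function.Injective w) :
    ∃ D, IsClub D ∧ ∀ δ ∈ D, ∀ l ≠ [], (∀ x ∈ l, x < δ) ↔ w l < δ := by
  have hcof : cof A = #A := cof_eq_cardinalMk
  have := nonempty_of_aleph0_lt_cof (hcof ▸ hA)
  have hentries (β : A) : BddAbove (⋃ l ∈ w ⁻¹' {β}, {x | x ∈ l}) :=
    ((Finite.biUnion ((finite_singleton β).preimage hw.injOn)
      fun l _ => l.finite_toSet)).bddAbove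
  have hcodes (β : A) : BddAbove (w '' {l | ∀ x ∈ l, x ∈ Iic β}) := by
    refine bddAbove_of_mk_lt_cof (mk_image_le.trans_lt ?_)
    rw [← range_list_map_coe, hcof]
    exact mk_range_le.trans_lt ((mk_list_le_max _).trans_lt
      (max_lt hA (mk_Iic_lt β ord_cardinalMk hA.le)))
  choose f hf using hentries
  choose g hg using hcodes
  refine ⟨_, (isClub_setOf_forall_lt hA f).inter (hcof ▸ hA.ne') (isClub_setOf_forall_lt hA g),
    fun δ hδ l hl => ⟨fun h => ?_, fun h x hx => ?_⟩⟩
  · obtain ⟨b, hb, hmax⟩ := l.toFinset.exists_max_image id (List.toFinset_nonempty_iff l |>.2 hl)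
    simp only [List.mem_toFinset] at hb hmax
    exact (hg b (mem_image_of_mem w hmax)).trans_lt (hδ.2 b (h b hb))
  · exact (hf (w l) (mem_biUnion rfl hx)).trans_lt (hδ.1 (w l) h)

end ClubGuessing

section Rays

variable {V W : Type u} {G : SimpleGraph V} {H : SimpleGraph W}

namespace Ray

/-- The image of a ray under an embedding of graphs that need not be induced. -/
def map (φ : G.Copy H) (R : Ray G) : Ray H :=
  ⟨fun n => φ (R.vertex n), φ.injective.comp R.injective, fun n => φ.toHom.map_adj (R.adj n)⟩

/-- The tail of a ray obtained by deleting its first `m` vertices. -/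
def drop (R : Ray G) (m : ℕ) : Ray G :=
  ⟨fun n => R.vertex (m + n), R.injective.comp (add_right_injective m), fun n => R.adj (m + n)⟩

/-- A ray with all vertices in `s`, as a ray of the subgraph induced on `s`. -/
def induce (R : Ray G) {s : Set V} (h : ∀ n, R.vertex n ∈ s) : Ray (G.induce s) :=
  ⟨fun n => ⟨R.vertex n, h n⟩, fun _ _ hab => R.injective (congrArg Subtype.val hab), R.adj⟩

theorem tailEquivalent_iff {R R' : Ray G} :
    R.TailEquivalent R' ↔ ∃ m m', ∀ n, R.vertex (m + n) = R'.vertex (m' + n) :=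
  ⟨fun ⟨_, ⟨m, hm⟩, ⟨m', hm'⟩⟩ => ⟨m, m', fun n => (hm n).symm.trans (hm' n)⟩,
    fun ⟨m, m', h⟩ => ⟨R.drop m, ⟨m, fun _ => rfl⟩, ⟨m', h⟩⟩⟩

theorem TailEquivalent.symm {R R' : Ray G} : R.TailEquivalent R' → R'.TailEquivalent R :=
  fun ⟨T, h, h'⟩ => ⟨T, h', h⟩

theorem TailEquivalent.trans {R Q R' : Ray G} (h : R.TailEquivalent Q)
    (h' : Q.TailEquivalent R') : R.TailEquivalent R' := by
  obtain ⟨m, m', hm⟩ := tailEquivalent_iff.1 h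
  obtain ⟨k, k', hk⟩ := tailEquivalent_iff.1 h'
  refine tailEquivalent_iff.2 ⟨m + k, k' + m', fun n => ?_⟩
  rw [add_assoc, hm, add_left_comm, hk, add_assoc]

end Ray

/-- Every ray in the neighbourhood of a vertex `v` eventually runs along the sequence `ρ v`. -/
def CapturesRays (G : SimpleGraph V) (ρ : V → ℕ → V) : Prop :=
  ∀ (v : V) (R : Ray G), (∀ n, G.Adj v (R.vertex n)) →
    ∃ m m', ∀ n, R.vertex (m + n) = ρ v (m' + n)

theorem OneRay.exists_capturesRays (hG : OneRay V G) : ∃ ρ, CapturesRays G ρ := by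
  suffices ∀ v, ∃ s : ℕ → V, ∀ R : Ray G, (∀ n, G.Adj v (R.vertex n)) →
      ∃ m m', ∀ n, R.vertex (m + n) = s (m' + n) from Classical.skolem.1 this
  intro v
  cases isEmpty_or_nonempty (Ray (G.induce (G.neighborSet v))) with
  | inl h => exact ⟨fun _ => v, fun R hR => (h.false (R.induce hR)).elim⟩
  | inr h =>
    obtain ⟨Q⟩ := h
    refine ⟨fun n => Q.vertex n, fun R hR => ?_⟩
    obtain ⟨m, m', h⟩ := Ray.tailEquivalent_iff.1 (hG v (R.induce hR) Q)
    exact ⟨m, m', fun n => congrArg Subtype.val (h n)⟩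

end Rays

section ApexGraph

variable {V I : Type u} {T : SimpleGraph V} {S : I → Set V}

/-- The graph `T` together with apices, where the apex `i` is joined to the vertices in `S i`. -/
def apexGraph (T : SimpleGraph V) (S : I → Set V) : SimpleGraph (V ⊕ I) where
  Adj
    | .inl u, .inl v => T.Adj u v
    | .inl v, .inr i => v ∈ S i
    | .inr i, .inl v => v ∈ S i
    | .inr _, .inr _ => False
  symm := ⟨by
    rintro (u | i) (v | j) h
    · exact h.symm
    all_goals exact h⟩
  loopless := ⟨by
    rintro (v | i) h
    · exact T.loopless.irrefl v h
    · exact h⟩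

theorem apexGraph_adj_inl_inl {u v : V} :
    (apexGraph T S).Adj (.inl u) (.inl v) ↔ T.Adj u v := Iff.rfl

theorem apexGraph_adj_inr_inl {i : I} {v : V} :
    (apexGraph T S).Adj (.inr i) (.inl v) ↔ v ∈ S i := Iff.rfl

theorem apexGraph_not_adj_inr_inr {i j : I} : ¬ (apexGraph T S).Adj (.inr i) (.inr j) := id

theorem exists_alternating_of_ray (hT : T.CliqueFree 3) {v : V}
    (R : Ray ((apexGraph T S).induce ((apexGraph T S).neighborSet (.inl v)))) :
    ∃ (q : ℕ → V) (i : ℕ → I), Function.Injective q ∧ Function.Injective i ∧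
      ∀ n, T.Adj v (q n) ∧ q n ∈ S (i n) ∧ q (n + 1) ∈ S (i n) := by
  classical
  let u (n : ℕ) : V ⊕ I := (R.vertex n).1
  have hinj : Function.Injective u := Subtype.val_injective.comp R.injective
  have hadj (n : ℕ) : (apexGraph T S).Adj (u n) (u (n + 1)) := R.adj n
  have hv (n : ℕ) : (apexGraph T S).Adj (.inl v) (u n) := (R.vertex n).2
  have hapex {n : ℕ} {q : V} (hq : u n = .inl q) : ∃ i, u (n + 1) = .inr i := by
    cases h : u (n + 1) with
    | inl q' =>
      refine (hT {v, q, q'} (SimpleGraph.is3Clique_triple_iff.2 ⟨?_, ?_, ?_⟩)).elim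
      · exact apexGraph_adj_inl_inl.1 (hq ▸ hv n)
      · exact apexGraph_adj_inl_inl.1 (h ▸ hv (n + 1))
      · exact apexGraph_adj_inl_inl.1 (h ▸ hq ▸ hadj n)
    | inr i => exact ⟨i, rfl⟩
  have hbase {n : ℕ} {i : I} (hi : u n = .inr i) : ∃ q, u (n + 1) = .inl q := by
    cases h : u (n + 1) with
    | inl q => exact ⟨q, rfl⟩
    | inr j => exact absurd (h ▸ hi ▸ hadj n) apexGraph_not_adj_inr_inr
  obtain ⟨k, hk⟩ : ∃ k, ∃ q, u k = .inl q := by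
    cases h : u 0 with
    | inl q => exact ⟨0, q, h⟩
    | inr i => exact ⟨1, hbase h⟩
  have heven (n : ℕ) : ∃ q, u (k + 2 * n) = .inl q := by
    induction n with
    | zero => exact hk
    | succ n ih =>
      obtain ⟨q, hq⟩ := ih
      obtain ⟨i, hi⟩ := hapex hq
      exact hbase hi
  choose q hq using heven
  choose i hi using fun n => hapex (hq n)
  refine ⟨q, i, fun a b hab => ?_, fun a b hab => ?_, fun n => ⟨?_, ?_, ?_⟩⟩
  · have := hinj ((hq a).trans (hab ▸ (hq b).symm))
    omega
  · have := hinj ((hi a).trans (hab ▸ (hi b).symm))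
    omega
  · exact apexGraph_adj_inl_inl.1 (hq n ▸ hv (k + 2 * n))
  · exact apexGraph_adj_inr_inl.1 (hi n ▸ hq n ▸ (hadj (k + 2 * n)).symm)
  · exact apexGraph_adj_inr_inl.1 (hi n ▸ hq (n + 1) ▸ hadj (k + 2 * n + 1))

theorem isEmpty_ray_neighborSet_inl_of_subsingleton [Subsingleton I] (hT : T.CliqueFree 3)
    (v : V) : IsEmpty (Ray ((apexGraph T S).induce ((apexGraph T S).neighborSet (.inl v)))) :=
  ⟨fun R => by
    obtain ⟨_, i, _, hi, _⟩ := exists_alternating_of_ray hT R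
    exact zero_ne_one (hi (Subsingleton.elim (i 0) (i 1)))⟩

theorem isEmpty_ray_neighborSet_inl (hT : T.CliqueFree 3) {v p : V}
    (hS : ∀ i, ((S i ∩ T.neighborSet v) \ {p}).Subsingleton) :
    IsEmpty (Ray ((apexGraph T S).induce ((apexGraph T S).neighborSet (.inl v)))) :=
  ⟨fun R => by
    obtain ⟨q, i, hq, -, h⟩ := exists_alternating_of_ray hT R
    have hp (n : ℕ) : q n = p ∨ q (n + 1) = p := by
      by_contra! hne
      have := hq (hS (i n) ⟨⟨(h n).2.1, (h n).1⟩, hne.1⟩ ⟨⟨(h n).2.2, (h (n + 1)).1⟩, hne.2⟩)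
      omega
    rcases hp 0 with h0 | h0 <;> rcases hp 2 with h2 | h2 <;>
      exact absurd (hq (h0.trans h2.symm)) (by omega)⟩

theorem Ray.exists_map_eq_of_inr {i : I}
    (R : Ray ((apexGraph T S).induce ((apexGraph T S).neighborSet (.inr i)))) :
    ∃ Q : Ray T, (∀ n, Q.vertex n ∈ S i) ∧ ∀ n, (R.vertex n).1 = .inl (Q.vertex n) := by
  have hi (n : ℕ) : (apexGraph T S).Adj (.inr i) (R.vertex n).1 := (R.vertex n).2
  have hbase (n : ℕ) : ∃ v, (R.vertex n).1 = .inl v := by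
    cases h : (R.vertex n).1 with
    | inl v => exact ⟨v, rfl⟩
    | inr j => exact absurd (h ▸ hi n) apexGraph_not_adj_inr_inr
  choose q hq using hbase
  refine ⟨⟨q, fun a b hab => R.injective (Subtype.ext ?_), fun n => ?_⟩, fun n => ?_, hq⟩
  · rw [hq, hq, hab]
  · have hadj : (apexGraph T S).Adj (R.vertex n).1 (R.vertex (n + 1)).1 := R.adj n
    rwa [hq, hq] at hadj
  · exact apexGraph_adj_inr_inl.1 (hq n ▸ hi n)

theorem oneRay_apexGraph
    (hbase : ∀ v, IsEmpty (Ray ((apexGraph T S).induce ((apexGraph T S).neighborSet (.inl v)))))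
    (hapex : ∀ i, ∃ B : Ray T, ∀ Q : Ray T, (∀ n, Q.vertex n ∈ S i) → Q.TailEquivalent B) :
    OneRay _ (apexGraph T S) := by
  rintro (v | i) R R'
  · exact ((hbase v).false R).elim
  · obtain ⟨Q, hQ, hR⟩ := R.exists_map_eq_of_inr
    obtain ⟨Q', hQ', hR'⟩ := R'.exists_map_eq_of_inr
    obtain ⟨B, hB⟩ := hapex i
    obtain ⟨m, m', h⟩ := Ray.tailEquivalent_iff.1 ((hB Q hQ).trans (hB Q' hQ').symm)
    exact Ray.tailEquivalent_iff.2 ⟨m, m', fun n => Subtype.ext (by rw [hR, hR', h])⟩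

end ApexGraph

section ListTree

variable {L I : Type u}

/-- The tree of finite sequences, where the last entry of a sequence is the head of the list. -/
def listTree (L : Type u) : SimpleGraph (List L) where
  Adj l l' := (∃ a, l' = a :: l) ∨ ∃ a, l = a :: l'
  symm := ⟨fun _ _ => Or.symm⟩
  loopless := ⟨fun l h => by simp at h⟩

theorem listTree_cliqueFree : (listTree L).CliqueFree 3 := by
  refine (SimpleGraph.Coloring.mk (fun l => l.length.bodd) ?_).colorable.cliqueFree (by simp)
  rintro l _ (⟨a, rfl⟩ | ⟨a, rfl⟩) <;> simp

theorem Ray.eventually_cons (R : Ray (listTree L)) :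
    ∃ k, ∀ n, ∃ a, R.vertex (k + n + 1) = a :: R.vertex (k + n) := by
  obtain ⟨k, hk⟩ : ∃ k, ∃ a, R.vertex (k + 1) = a :: R.vertex k := by
    by_contra! h
    have hdown (n : ℕ) : (R.vertex n).length + n = (R.vertex 0).length := by
      induction n with
      | zero => rfl
      | succ n ih =>
        obtain ⟨a, ha⟩ := (R.adj n).resolve_left fun ⟨a, ha⟩ => h n a ha
        rw [← ih, ha, List.length_cons]
        omega
    have := hdown ((R.vertex 0).length + 1)
    omega
  refine ⟨k, fun n => ?_⟩
  induction n with
  | zero => exact hk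
  | succ n ih =>
    obtain ⟨a, ha⟩ := ih
    refine (R.adj (k + n + 1)).resolve_right fun ⟨b, hb⟩ => ?_
    have := R.injective (List.cons.inj (ha.symm.trans hb)).2
    omega

/-- The ray of the finite initial segments of `s`, each listed with its last entry first. -/
def branch (s : ℕ → L) : Ray (listTree L) where
  vertex n := ((List.range n).map s).reverse
  injective m n h := by simpa using congrArg List.length h
  adj n := .inl ⟨s n, by simp [List.range_succ]⟩

theorem length_branch (s : ℕ → L) (n : ℕ) : ((branch s).vertex n).length = n := by simp [branch]

theorem branch_succ (s : ℕ → L) (n : ℕ) :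
    (branch s).vertex (n + 1) = s n :: (branch s).vertex n := by simp [branch, List.range_succ]

theorem eq_branch_length {s : ℕ → L} {l : List L} (hl : l ∈ Set.range (branch s).vertex) :
    l = (branch s).vertex l.length := by
  obtain ⟨n, rfl⟩ := hl
  rw [length_branch]

theorem Ray.tailEquivalent_branch {R : Ray (listTree L)} {s : ℕ → L} {k : ℕ}
    (h : ∀ n, R.vertex (k + n) ∈ Set.range (branch s).vertex) : R.TailEquivalent (branch s) := by
  obtain ⟨j, hj⟩ := R.eventually_cons
  have hlen (n : ℕ) : (R.vertex (j + n)).length = (R.vertex j).length + n := by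
    induction n with
    | zero => rfl
    | succ n ih =>
      obtain ⟨a, ha⟩ := hj n
      rw [← add_assoc, ha, List.length_cons, ih, add_assoc]
  refine tailEquivalent_iff.2 ⟨j + k, (R.vertex j).length + k, fun n => ?_⟩
  have hmem : R.vertex (j + k + n) ∈ Set.range (branch s).vertex := by
    rw [add_comm j k, add_assoc]; exact h _
  rw [eq_branch_length hmem, add_assoc j, hlen, add_assoc]

/-- The tree of finite sequences in which the apex `i` is joined to the initial segments of
`s i`. -/
def branchGraph (s : I → ℕ → L) : SimpleGraph (List L ⊕ I) :=
  apexGraph (listTree L) fun i => Set.range (branch (s i)).vertex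

theorem oneRay_branchGraph (s : I → ℕ → L) : OneRay _ (branchGraph s) := by
  refine oneRay_apexGraph
    (fun l => isEmpty_ray_neighborSet_inl listTree_cliqueFree (p := l.tail) ?_)
    fun i => ⟨branch (s i), fun Q hQ => Q.tailEquivalent_branch (k := 0) fun n => hQ _⟩
  rintro i x ⟨⟨hx, hlx⟩, hxl⟩ y ⟨⟨hy, hly⟩, hyl⟩
  obtain ⟨a, rfl⟩ := hlx.resolve_right fun ⟨_, h⟩ => hxl (h ▸ rfl)
  obtain ⟨b, rfl⟩ := hly.resolve_right fun ⟨_, h⟩ => hyl (h ▸ rfl)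
  exact (eq_branch_length hx).trans (eq_branch_length hy).symm

end ListTree

section WeakComplexity

theorem GraphClass.OfCard.WeakLE.refl {C : GraphClass.{u}} {κ : Cardinal.{u}} (x : C.OfCard κ) :
    x.WeakLE x :=
  Quotient.inductionOn x fun _ => ⟨.id _⟩

theorem le_weakComplexity {V : Type u} {c : Cardinal.{u}}
    (h : ∀ (J : Type u) (G : J → SimpleGraph V), #J < c → (∀ j, OneRay V (G j)) →
      ∃ (W : Type u) (H : SimpleGraph W), #W = #V ∧ OneRay W H ∧ ∀ j, ¬ H.IsContained (G j)) :
    c ≤ GraphClass.weakComplexity OneRay #V := by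
  refine le_csInf ⟨_, Set.univ, rfl, fun x => ⟨x, trivial, .refl x⟩⟩ ?_
  rintro _ ⟨D, rfl, hD⟩
  by_contra! hlt
  let e (y : D) := SimpleGraph.Iso.map outMkEquiv y.1.out.1
  obtain ⟨W, H, hW, hH, hnot⟩ := h D _ hlt fun y => OneRay.of_iso (e y) y.1.out.2
  obtain ⟨H', ⟨f⟩⟩ := OneRay.exists_iso_member hW H hH
  obtain ⟨y, hy, hle⟩ := hD ⟦H'⟧
  rw [← y.out_eq] at hle
  obtain ⟨φ⟩ := hle
  exact hnot ⟨y, hy⟩ ⟨(e ⟨y, hy⟩).toCopy.comp (φ.comp f.toCopy)⟩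

end WeakComplexity

section Diagonal

variable {V K : Type u}

/-- The descending finite sequences of the relation `r`, as nodes of the tree of all finite
sequences, form with the branch `s` the neighbourhood of a single apex. -/
def chainGraph {L : Type u} (r : L → L → Prop) (s : ℕ → L) : SimpleGraph (List L ⊕ PUnit.{u + 1}) :=
  apexGraph (listTree L) fun _ => {l | l.IsChain r} ∪ Set.range (branch s).vertex

theorem chainGraph_adj_inr_inl {L : Type u} {r : L → L → Prop} {s : ℕ → L} {l : List L} :
    (chainGraph r s).Adj (.inr ⟨⟩) (.inl l) ↔ l.IsChain r ∨ l ∈ Set.range (branch s).vertex :=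
  Iff.rfl

theorem Ray.exists_forall_not_isChain {L : Type u} {r : L → L → Prop} (hr : WellFounded r)
    (Q : Ray (listTree L)) : ∃ k, ∀ n, ¬ (Q.vertex (k + n)).IsChain r := by
  obtain ⟨k, hk⟩ := Q.eventually_cons
  choose a ha using hk
  obtain ⟨m, hm⟩ : ∃ m, ¬ (Q.vertex (k + m)).IsChain r := by
    by_contra! hchain
    refine (wellFounded_iff_isEmpty_descending_chain.1 hr).false ⟨a, fun n => ?_⟩
    have h : (Q.vertex (k + (n + 1) + 1)).IsChain r := hchain (n + 2)
    rw [ha (n + 1), ← add_assoc, ha n] at h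
    exact h.rel
  refine ⟨k + m, fun n => ?_⟩
  induction n with
  | zero => exact hm
  | succ n ih =>
    intro h
    rw [← add_assoc, add_assoc k, ha] at h
    exact ih (add_assoc k m n ▸ h.of_cons)

theorem oneRay_chainGraph {L : Type u} {r : L → L → Prop} (hr : WellFounded r) (s : ℕ → L) :
    OneRay _ (chainGraph r s) := by
  refine oneRay_apexGraph (isEmpty_ray_neighborSet_inl_of_subsingleton listTree_cliqueFree)
    fun _ => ⟨branch s, fun Q hQ => ?_⟩
  obtain ⟨k, hk⟩ := Q.exists_forall_not_isChain hr
  exact Q.tailEquivalent_branch fun n => (hQ (k + n)).resolve_left (hk n)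

/-- For a family `H` of graphs, `PathExtension H (k, t) (k, s)` says that the path `t` in `H k`
extends the path `s` by one vertex, which becomes the head of the list `t`. -/
def PathExtension (H : K → SimpleGraph V) (t s : K × List V) : Prop :=
  t.1 = s.1 ∧ (∃ a, t.2 = a :: s.2) ∧ t.2.IsChain (H t.1).Adj ∧ t.2.Nodup

theorem wellFounded_pathExtension {H : K → SimpleGraph V} (hH : ∀ k, IsEmpty (Ray (H k))) :
    WellFounded (PathExtension H) := by
  refine wellFounded_iff_isEmpty_descending_chain.2 ⟨fun ⟨f, hf⟩ => ?_⟩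
  have hcons (n : ℕ) := (hf n).2.1
  choose a ha using hcons
  have hfst (n : ℕ) : (f n).1 = (f 0).1 := by
    induction n with
    | zero => rfl
    | succ n ih => exact (hf n).1.trans ih
  have hmem {m n : ℕ} (h : m < n) : a m ∈ (f n).2 := by
    induction n, h using Nat.le_induction with
    | base => exact ha m ▸ List.mem_cons_self
    | succ n _ ih => exact ha n ▸ List.mem_cons_of_mem _ ih
  have hne {m n : ℕ} (h : m < n) : a m ≠ a n := fun he =>
    (List.nodup_cons.1 (ha n ▸ (hf n).2.2.2)).1 (he ▸ hmem h)
  refine (hH (f 0).1).false ⟨a, fun m n h => ?_, fun n => ?_⟩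
  · by_contra hmn
    exact (Nat.lt_or_gt_of_ne hmn).elim (hne · h) (hne · h.symm)
  · have h := (hf (n + 1)).2.2.1
    rw [ha, ha, hfst] at h
    exact h.rel.symm

theorem nodup_map_tails {L : Type u} {g : List L → V} (hg : Function.Injective g) (l : List L) :
    (l.tails.map g).Nodup := by
  induction l with
  | nil => exact List.nodup_singleton _
  | cons a l ih =>
    rw [List.tails_cons, List.map_cons]
    refine List.nodup_cons.2 ⟨fun hmem => ?_, ih⟩
    have := (List.mem_tails _ _).1 ((List.mem_map_of_injective hg).1 hmem)
    simpa using this.length_le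

theorem isChain_map_tails {L : Type u} {r : L → L → Prop} {G : SimpleGraph V} {g : List L → V}
    (hadj : ∀ a l, (a :: l).IsChain r → G.Adj (g l) (g (a :: l))) {l : List L}
    (hl : l.IsChain r) : (l.tails.map g).IsChain G.Adj := by
  induction l with
  | nil => exact List.isChain_singleton _
  | cons a l ih =>
    have := (hadj a l hl).symm
    have := ih hl.of_cons
    cases l <;> simp_all

theorem exists_isChain_pathExtension_not_adj {H : K → SimpleGraph V} (k : K)
    (hH : IsEmpty (Ray (H k))) {g : List (K × List V) → V} (hg : Function.Injective g) :
    ∃ a l, (a :: l).IsChain (PathExtension H) ∧ ¬ (H k).Adj (g l) (g (a :: l)) := by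
  by_contra! hadj
  let l : ℕ → List (K × List V) := Nat.rec [] fun _ l => (k, l.tails.map g) :: l
  have hl (n : ℕ) : l (n + 1) = (k, (l n).tails.map g) :: l n := rfl
  have hchain (n : ℕ) : (l (n + 1)).IsChain (PathExtension H) := by
    induction n with
    | zero => exact List.isChain_singleton _
    | succ n ih =>
      refine List.isChain_cons_cons.2 ⟨⟨rfl, ⟨g (l (n + 1)), ?_⟩, isChain_map_tails hadj ih,
        nodup_map_tails hg _⟩, ih⟩
      rw [hl, List.tails_cons, List.map_cons]
  have hlen (n : ℕ) : (l n).length = n := by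
    induction n with
    | zero => rfl
    | succ n ih => rw [hl, List.length_cons, ih]
  exact hH.false ⟨fun n => g (l n), fun m n h => by rw [← hlen m, hg h, hlen],
    fun n => hadj _ _ (hchain n)⟩

/-- The subgraph of `G` on the neighbours of `v` outside the tail of `ρ v` that starts
at `ρ v m`. -/
def residualGraph (G : SimpleGraph V) (ρ : V → ℕ → V) (v : V) (m : ℕ) : SimpleGraph V :=
  (G.induce {x | G.Adj v x ∧ ∀ n, x ≠ ρ v (m + n)}).spanningCoe

variable {G : SimpleGraph V} {ρ : V → ℕ → V}

theorem residualGraph_adj {v : V} {m : ℕ} {x y : V} :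
    (residualGraph G ρ v m).Adj x y ↔ (G.Adj v x ∧ ∀ n, x ≠ ρ v (m + n)) ∧
      (G.Adj v y ∧ ∀ n, y ≠ ρ v (m + n)) ∧ G.Adj x y := by
  simp only [residualGraph, SimpleGraph.map_adj, SimpleGraph.comap_adj,
    Function.Embedding.subtype_apply, Subtype.exists, Set.mem_ofPred_eq]
  grind

theorem CapturesRays.isEmpty_ray_residualGraph (hρ : CapturesRays G ρ) (v : V) (m : ℕ) :
    IsEmpty (Ray (residualGraph G ρ v m)) :=
  ⟨fun R => by
    have hR (n : ℕ) := residualGraph_adj.1 (R.adj n)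
    obtain ⟨k, k', h⟩ := hρ v ⟨R.vertex, R.injective, fun n => (hR n).2.2⟩ fun n => (hR n).1.1
    exact (hR (k + m)).1.2 k' (by rw [h, add_comm])⟩

theorem not_chainGraph_isContained {H : K → SimpleGraph V} (hH : ∀ k, IsEmpty (Ray (H k)))
    (hρ : CapturesRays G ρ) (hres : ∀ v m, residualGraph G ρ v m ∈ Set.range H)
    (z : K × List V) : ¬ (chainGraph (PathExtension H) fun _ => z).IsContained G := by
  rintro ⟨φ⟩
  let g (l : List (K × List V)) : V := φ (.inl l)
  have hg : Function.Injective g := φ.injective.comp Sum.inl_injective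
  have htree {l l'} (h : (listTree _).Adj l l') : G.Adj (g l) (g l') := φ.toHom.map_adj h
  have hapex {l} (h : l.IsChain (PathExtension H) ∨ l ∈ Set.range (branch fun _ => z).vertex) :
      G.Adj (φ (.inr ⟨⟩)) (g l) := φ.toHom.map_adj (chainGraph_adj_inr_inl.2 h)
  let R : Ray G := ((branch fun _ => z).drop 2).map ⟨⟨g, htree⟩, hg⟩
  obtain ⟨m, m', hR⟩ := hρ (φ (.inr ⟨⟩)) R fun n => hapex (.inr ⟨_, rfl⟩)
  have hnot {l} (h : l.IsChain (PathExtension H)) (n : ℕ) : g l ≠ ρ (φ (.inr ⟨⟩)) (m' + n) := by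
    intro hl
    have hbranch : l = (branch fun _ => z).vertex (2 + (m + n)) := hg (hl.trans (hR n).symm)
    rw [hbranch, add_comm 2, branch_succ, branch_succ] at h
    obtain ⟨-, ⟨_, ha⟩, -⟩ := h.rel
    simpa using congrArg List.length ha
  obtain ⟨k, hk⟩ := hres (φ (.inr ⟨⟩)) m'
  obtain ⟨a, l, h, hadj⟩ := exists_isChain_pathExtension_not_adj k (hH k) hg
  rw [hk, residualGraph_adj] at hadj
  exact hadj ⟨⟨hapex (.inl h.of_cons), hnot h.of_cons⟩, ⟨hapex (.inl h), hnot h⟩,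
    htree (.inl ⟨a, rfl⟩)⟩

theorem exists_oneRay_forall_not_isContained [Infinite V] {J : Type u} (hJ : #J ≤ #V)
    {G : J → SimpleGraph V} (hG : ∀ j, OneRay V (G j)) :
    ∃ (W : Type u) (H : SimpleGraph W), #W = #V ∧ OneRay W H ∧ ∀ j, ¬ H.IsContained (G j) := by
  cases isEmpty_or_nonempty J with
  | inl => exact ⟨V, ⊥, rfl, fun v R => ((R.vertex 0).2 : False).elim, isEmptyElim⟩
  | inr =>
    choose ρ hρ using fun j => (hG j).exists_capturesRays
    let H (k : J × V × ℕ) : SimpleGraph V := residualGraph (G k.1) (ρ k.1) k.2.1 k.2.2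
    have hH (k) : IsEmpty (Ray (H k)) := (hρ k.1).isEmpty_ray_residualGraph _ _
    have hV : ℵ₀ ≤ #V := aleph0_le_mk V
    have hL : #((J × V × ℕ) × List V) = #V := by
      simp only [mk_prod, lift_uzero, mk_nat, lift_aleph0, mk_list_eq_mk, lift_id,
        mul_aleph0_eq hV, mul_eq_right hV hJ (mk_ne_zero J), mul_eq_self hV]
    have : Infinite ((J × V × ℕ) × List V) := infinite_iff.2 (hL ▸ hV)
    obtain ⟨z⟩ : Nonempty ((J × V × ℕ) × List V) := inferInstance
    refine ⟨_, chainGraph (PathExtension H) fun _ => z, ?_,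
      oneRay_chainGraph (wellFounded_pathExtension hH) _,
      fun j => not_chainGraph_isContained hH (hρ j) (fun v m => ⟨(j, v, m), rfl⟩) z⟩
    simp only [mk_sum, lift_id, mk_list_eq_mk, hL, mk_punit, add_one_eq hV]

theorem succ_le_weakComplexity {κ : Cardinal.{u}} (hκ : ℵ₀ ≤ κ) :
    Order.succ κ ≤ GraphClass.weakComplexity OneRay κ := by
  have : Infinite κ.out := infinite_iff.2 (by rwa [mk_out])
  rw [← mk_out κ]
  exact le_weakComplexity fun J G hJ hG =>
    exists_oneRay_forall_not_isContained (Order.lt_succ_iff.1 hJ) hG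

end Diagonal

section Coding

variable {A V : Type u}

/-- The subsequence of `c` that picks one term from each pair `c (2 * n)`, `c (2 * n + 1)`
according to a bit of `x`. The pairing function makes every bit recur infinitely often, so that
each tail of the subsequence determines `x`. -/
def codedSubsequence (c : ℕ → A) (x : ℕ → Bool) (n : ℕ) : A := c (2 * n + (x n.unpair.1).toNat)

theorem forall_codedSubsequence_lt_iff [LinearOrder A] {c : ℕ → A} (hc : StrictMono c)
    (x : ℕ → Bool) (n : ℕ) :
    (∀ a ∈ (branch (codedSubsequence c x)).vertex (n + 1), a < c (2 * n + 1)) ↔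
      x n.unpair.1 = false := by
  have hle (k : ℕ) : (x k.unpair.1).toNat ≤ 1 := Bool.toNat_le _
  simp only [branch, List.mem_reverse, List.forall_mem_map, List.mem_range, codedSubsequence,
    hc.lt_iff_lt, ← Bool.toNat_eq_zero]
  refine ⟨fun h => ?_, fun h k hk => ?_⟩
  · have := h n n.lt_succ_self
    omega
  · have := hle k
    rcases Nat.lt_succ_iff_lt_or_eq.1 hk with hk | rfl <;> omega

theorem eq_of_forall_add_unpair_eq {x y : ℕ → Bool} {m : ℕ}
    (h : ∀ n, x (m + n).unpair.1 = y (m + n).unpair.1) : x = y := by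
  funext a
  have := h (Nat.pair a m - m)
  rwa [Nat.add_sub_cancel' (Nat.right_le_pair a m), Nat.unpair_pair] at this

variable [LinearOrder A] [WellFoundedLT A] [IsRegularCardinalOrder A]
  {G : SimpleGraph A} {ρ : A → ℕ → A} {c : A → ℕ → A}

theorem exists_forall_eq_true_iff_le (hA : ℵ₀ < #A) (hc : ∀ i, StrictMono (c i))
    (hguess : ∀ D, IsClub D → ∃ i, ∀ n, c i n ∈ D) (hρ : CapturesRays G ρ) {x : ℕ → Bool}
    (hG : (branchGraph fun i => codedSubsequence (c i) x).IsContained G) :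
    ∃ i v m m', ∀ n, x (m + n).unpair.1 = true ↔ c i (2 * (m + n) + 1) ≤ ρ v (m' + n) := by
  obtain ⟨φ⟩ := hG
  let w (l : List A) : A := φ (.inl l)
  have hw : Function.Injective w := φ.injective.comp Sum.inl_injective
  have htree {l l'} (h : (listTree A).Adj l l') : G.Adj (w l) (w l') := φ.toHom.map_adj h
  obtain ⟨D, hD, hDw⟩ := exists_isClub_forall_mem_lt_iff hA hw
  obtain ⟨i, hi⟩ := hguess D hD
  let B := branch (codedSubsequence (c i) x)
  obtain ⟨m, m', hm⟩ := hρ (φ (.inr i)) ((B.drop 1).map ⟨⟨w, htree⟩, hw⟩) fun n =>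
    φ.toHom.map_adj (apexGraph_adj_inr_inl.2 ⟨_, rfl⟩)
  refine ⟨i, φ (.inr i), m, m', fun n => ?_⟩
  have hρB : w (B.vertex (m + n + 1)) = ρ (φ (.inr i)) (m' + n) := by
    rw [← hm, add_comm (m + n)]; rfl
  rw [← Bool.not_eq_false, ← not_lt, not_iff_not, ← forall_codedSubsequence_lt_iff (hc i), ← hρB]
  exact hDw _ (hi _) _ fun h => absurd (congrArg List.length h) (by rw [length_branch]; simp)

end Coding

section Continuum

theorem exists_oneRay_forall_not_isContained_of_lt_two_power_aleph0 {A : Type u}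
    [LinearOrder A] [WellFoundedLT A] [IsRegularCardinalOrder A] (hA : ℵ_ 1 < #A)
    (hA' : #A < 2 ^ (ℵ₀ : Cardinal.{u})) {J : Type u} (hJ : #J < 2 ^ (ℵ₀ : Cardinal.{u}))
    {G : J → SimpleGraph A} (hG : ∀ j, OneRay A (G j)) :
    ∃ (W : Type u) (H : SimpleGraph W), #W = #A ∧ OneRay W H ∧ ∀ j, ¬ H.IsContained (G j) := by
  have hA0 : ℵ₀ < #A := aleph0_lt_aleph_one.trans hA
  have : Infinite A := infinite_iff.2 hA0.le
  obtain ⟨c, hc, hguess⟩ := exists_club_guessing (Order.cof_eq_cardinalMk (α := A) ▸ hA)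
  choose ρ hρ using fun j => (hG j).exists_capturesRays
  by_contra! hcon
  have hcopy (x : ℕ → Bool) :
      ∃ j, (branchGraph fun i => codedSubsequence (c i) x).IsContained (G j) :=
    hcon _ _ (by rw [mk_sum, lift_id, lift_id, mk_list_eq_mk, add_eq_self hA0.le])
      (oneRay_branchGraph _)
  choose j hj using hcopy
  choose i v m m' hdec using fun x => exists_forall_eq_true_iff_le hA0 hc hguess (hρ (j x)) (hj x)
  let code (x : ULift.{u} (ℕ → Bool)) : J × A × A × ℕ × ℕ :=
    (j x.down, i x.down, v x.down, m x.down, m' x.down)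
  have hcode : Function.Injective code := by
    rintro ⟨x⟩ ⟨y⟩ hxy
    simp only [code, Prod.mk.injEq] at hxy
    obtain ⟨hj, hi, hv, hm, hm'⟩ := hxy
    refine congrArg _ (eq_of_forall_add_unpair_eq (m := m x) fun n => ?_)
    rw [Bool.eq_iff_iff, hdec x n, hj, hi, hv, hm, hm', hdec y n]
  have hinf : (ℵ₀ : Cardinal.{u}) ≤ 2 ^ (ℵ₀ : Cardinal.{u}) := (cantor _).le
  have hlt : #(J × A × A × ℕ × ℕ) < 2 ^ (ℵ₀ : Cardinal.{u}) := by
    simp only [mk_prod, lift_uzero, mk_nat, lift_aleph0, aleph0_mul_aleph0, lift_id]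
    exact mul_lt_of_lt hinf hJ (mul_lt_of_lt hinf hA' (mul_lt_of_lt hinf hA' (cantor _)))
  exact (mk_le_of_injective hcode).not_gt (hlt.trans_eq (by simp))

theorem two_power_aleph0_le_weakComplexity {κ : Cardinal.{u}} (hreg : κ.IsRegular)
    (hκ : ℵ_ 1 < κ) (hκ' : κ < 2 ^ (ℵ₀ : Cardinal.{u})) :
    2 ^ (ℵ₀ : Cardinal.{u}) ≤ GraphClass.weakComplexity OneRay κ := by
  have : IsRegularCardinalOrder κ.ord.ToType := ⟨by
    rw [Ordinal.type_toType, Ordinal.cof_toType, hreg.cof_ord]⟩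
  rw [← mk_ord_toType κ] at hκ hκ' ⊢
  exact le_weakComplexity fun J G hJ hG =>
    exists_oneRay_forall_not_isContained_of_lt_two_power_aleph0 hκ hκ' hJ hG

end Continuum

end UncountableGraphs

theorem corollary1p9 (κ : Cardinal.{u}) (hreg : κ.IsRegular) (hκ : ℵ_ 1 < κ) :
    max (Order.succ κ) (2 ^ (ℵ₀ : Cardinal.{u})) ≤
      UncountableGraphs.GraphClass.weakComplexity UncountableGraphs.OneRay κ := by
  have hsucc := UncountableGraphs.succ_le_weakComplexity hreg.aleph0_le
  refine max_le hsucc ?_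
  rcases lt_or_ge κ (2 ^ (ℵ₀ : Cardinal.{u})) with hlt | hle
  · exact UncountableGraphs.two_power_aleph0_le_weakComplexity hreg hκ hlt
  · exact hle.trans ((Order.le_succ κ).trans hsucc)
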